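/- For $n\ge 0$ let $G_n=\sum_{k=0}^{n}\left(\frac{1\cdot 3\cdots(2k-1)}{2\cdot 4\cdots(2k)}\right)^2$ be the Landau constants (the term $k=0$ being $1$), let $N=n+1$, and let $\gamma$ be Euler's constant. Then $\pi G_n$ has an asymptotic expansion $$\pi G_n\sim \ln(16N)+\gamma+\sum_{k=1}^{\infty}\frac{\alpha_k}{N^k},\qquad n\to\infty,$$ with real constants $\alpha_k$, meaning that for every $l\ge 0$ $$\pi G_n-\ln(16N)-\gamma-\sum_{k=1}^{l}\frac{\alpha_k}{N^k}=o(N^{-l}),\qquad n\to\infty,$$ and its coefficients satisfy $$(-1)^{\frac{l(l+1)}{2}}\alpha_{l+1}<0\qquad\text{for all } l=0,1,2,\dots.$$ -/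

import Mathlib

open Filter Asymptotics

/-- The `n`-th Landau constant
`G_n = 1 + (1/2)^2 + (1·3/(2·4))^2 + ⋯ + (1·3⋯(2n-1)/(2·4⋯(2n)))^2`. -/
noncomputable def landauConstant (n : ℕ) : ℝ :=
  ∑ k ∈ Finset.range (n + 1),
    (∏ j ∈ Finset.range k, (2 * (j : ℝ) + 1) / (2 * (j : ℝ) + 2)) ^ 2

/-- The truncation `A_l(N) = ln(16 N) + γ + ∑_{k=1}^l α_k / N^k`. -/
noncomputable def granathTruncation (α : ℕ → ℝ) (l : ℕ) (N : ℝ) : ℝ :=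
  Real.log (16 * N) + Real.eulerMascheroniConstant
    + ∑ k ∈ Finset.Icc 1 l, α k / N ^ k

/-- `α_1, α_2, …` are the coefficients of the (Poincaré) asymptotic expansion
`π G_n ∼ ln(16 N) + γ + ∑_{k ≥ 1} α_k / N^k` as `n → ∞`, where `N = n + 1`: for every `l`,
the error of the truncation at order `l` is `o(N^{-l})`. The value `α 0` plays no role. -/
def IsGranathExpansion (α : ℕ → ℝ) : Prop :=
  ∀ l : ℕ,
    (fun n : ℕ => Real.pi * landauConstant n - granathTruncation α l ((n : ℝ) + 1))
      =o[atTop] (fun n : ℕ => 1 / ((n : ℝ) + 1) ^ l)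

/-! ### Wallis integrals and the leading behaviour of the central binomial ratio. -/

section CentralBinomialRatio

open Real Finset

/-! Write c_k = `cbRatio k`, N = n + 1, so that π G_n = ∑_{k<N} π c_k². Expansions in 1/N are
encoded by formal Borel transforms: B = ∑ b_k t^k stands for ∑ k! b_k / N^{k+1}. Multiplication by N
becomes d/dt (plus a constant), and N ↦ N + 1 becomes multiplication by e^{-t}.

The recurrence (N+1)² c_{N+1}² = (N+1/2)² c_N² turns into an ODE whose regular solution is T =
e^{-t/4} P_{-1/2}(cosh(t/2)), the transform of π c_N² (`borelTo_pi_mul_cbRatio_sq`). Summing over N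
divides by e^{-t} - 1. With the transform (1 - e^{-t})/t of log(N+1) - log N taken into account, π
G_n - log(16N) - γ has transform (1 - Λ)/t, where Λ = tT/(1 - e^{-t}). The recurrences fix the
sequences only up to a factor and an additive constant; N π c_N² → 1 and
`tendsto_sum_pi_mul_cbRatio_sq_sub_log` supply these.

Since e^{t/4} = cosh(t/4) + sinh(t/4) and 2 sinh(t/2) = 4 sinh(t/4) cosh(t/4), Λ =
P_{-1/2}(cosh(t/2)) · [(t/4)/sinh(t/4) + (t/4)/cosh(t/4)], an even plus an odd series. Under t ↦ it
the factors P_{-1/2}(cos(t/2)), (t/4)/sin(t/4) and 1/cos(t/4) have nonnegative coefficients, by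
recursions read off their differential equations. This fixes every sign (`sign_coeff_landauSeries`),
and uniqueness of asymptotic coefficients transfers it to any expansion. -/

/-- The central binomial ratio `1·3⋯(2k-1) / (2·4⋯(2k))`. -/
noncomputable def cbRatio (k : ℕ) : ℝ :=
  ∏ j ∈ range k, (2 * (j : ℝ) + 1) / (2 * (j : ℝ) + 2)

theorem cbRatio_succ (k : ℕ) :
    cbRatio (k + 1) = cbRatio k * ((2 * (k : ℝ) + 1) / (2 * (k : ℝ) + 2)) := by
  rw [cbRatio, prod_range_succ, cbRatio]

theorem cbRatio_pos (k : ℕ) : 0 < cbRatio k := prod_pos fun j _ => by positivity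

theorem integral_sin_pow_even_eq_cbRatio (k : ℕ) :
    ∫ x in (0 : ℝ)..π, sin x ^ (2 * k) = π * cbRatio k := integral_sin_pow_even k

/-- The even and odd Wallis products telescope against each other. Thus π c_k² - 2/(2k+1) is the
integral of c_k (sin^{2k} - sin^{2k+1}), which is what identifies the constant log 16 + γ. -/
theorem cbRatio_mul_integral_sin_pow_odd (k : ℕ) :
    cbRatio k * ∫ x in (0 : ℝ)..π, sin x ^ (2 * k + 1) = 2 / (2 * (k : ℝ) + 1) := by
  rw [integral_sin_pow_odd]
  induction k with
  | zero => simp [cbRatio]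
  | succ k ih =>
    rw [cbRatio_succ, prod_range_succ]
    have : ∀ p q r s t : ℝ, p * q * (r * (s * t)) = (p * (r * s)) * (q * t) := by intros; ring
    rw [this, ih]
    push_cast
    field_simp
    ring

theorem two_div_le_pi_mul_cbRatio_sq (k : ℕ) : 2 / (2 * (k : ℝ) + 1) ≤ π * cbRatio k ^ 2 := by
  rw [← cbRatio_mul_integral_sin_pow_odd]
  have h := integral_sin_pow_succ_le (n := 2 * k)
  rw [integral_sin_pow_even_eq_cbRatio] at h
  nlinarith [mul_le_mul_of_nonneg_left h (cbRatio_pos k).le]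

theorem pi_mul_cbRatio_sq_le (k : ℕ) : π * cbRatio (k + 1) ^ 2 ≤ 1 / ((k : ℝ) + 1) := by
  have h := integral_sin_pow_succ_le (n := 2 * k + 1)
  rw [show 2 * k + 1 + 1 = 2 * (k + 1) by ring, integral_sin_pow_even_eq_cbRatio] at h
  have h2 := mul_le_mul_of_nonneg_left h (cbRatio_pos (k + 1)).le
  rw [cbRatio_succ k] at h2 ⊢
  have h3 := cbRatio_mul_integral_sin_pow_odd k
  have h4 : cbRatio k * ((2 * (k : ℝ) + 1) / (2 * k + 2)) * ∫ x in (0 : ℝ)..π, sin x ^ (2 * k + 1)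
      = 1 / ((k : ℝ) + 1) := by
    rw [mul_right_comm, h3]
    field_simp
  rw [h4] at h2
  linarith

theorem tendsto_mul_pi_mul_cbRatio_sq :
    Tendsto (fun N : ℕ => (N : ℝ) * (π * cbRatio N ^ 2)) atTop (nhds 1) := by
  have h1 : Tendsto (fun N : ℕ => 1 - 1 / (2 * (N : ℝ) + 1)) atTop (nhds 1) := by
    have : Tendsto (fun N : ℕ => 2 * (N : ℝ) + 1) atTop atTop :=
      tendsto_atTop_add_const_right _ _ (tendsto_natCast_atTop_atTop.const_mul_atTop two_pos)
    simpa using (tendsto_const_nhds (x := (1 : ℝ))).sub (this.inv_tendsto_atTop)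
  refine tendsto_of_tendsto_of_tendsto_of_le_of_le h1 tendsto_const_nhds (fun N => ?_) fun N => ?_
  · have := mul_le_mul_of_nonneg_left (two_div_le_pi_mul_cbRatio_sq N) N.cast_nonneg
    refine le_trans (le_of_eq ?_) this
    field_simp
    ring
  · rcases N with _ | k
    · simp
    · have := mul_le_mul_of_nonneg_left (pi_mul_cbRatio_sq_le k) (k + 1).cast_nonneg (α := ℝ)
      refine this.trans (le_of_eq ?_)
      push_cast
      field_simp

/-! ### The constant term log 16 + γ. -/

theorem choose_half_eq_cbRatio (n : ℕ) :
    Ring.choose ((1 / 2 : ℝ) + n - 1) n = cbRatio n := by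
  rw [Ring.choose_eq_smul, Polynomial.descPochhammer_smeval_eq_ascPochhammer,
    Polynomial.ascPochhammer_smeval_eq_eval, show (1 / 2 : ℝ) + n - 1 - n + 1 = 1 / 2 by ring]
  induction n with
  | zero => simp [cbRatio]
  | succ n ih =>
    rw [cbRatio_succ, ← ih, ascPochhammer_succ_eval, Nat.factorial_succ]
    simp only [smul_eq_mul]
    push_cast
    field_simp
    ring

theorem hasSum_cbRatio_mul_pow {x : ℝ} (hx : |x| < 1) :
    HasSum (fun k => cbRatio k * x ^ k) (1 / √(1 - x)) := by
  have h := (one_div_one_sub_rpow_hasFPowerSeriesOnBall_zero (1 / 2)).hasSum (y := x)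
    (by simpa [enorm_eq_nnnorm, ← NNReal.coe_lt_coe] using hx)
  simp only [FormalMultilinearSeries.ofScalars_apply_eq, choose_half_eq_cbRatio, zero_add,
    smul_eq_mul, ← Real.sqrt_eq_rpow] at h
  exact h

theorem one_sub_sin_div_sqrt {x : ℝ} (hx : cos x ≠ 0) :
    1 / √(1 - sin x ^ 2) * (1 - sin x) = |cos x| / (1 + sin x) := by
  rw [← cos_sq', sqrt_sq_eq_abs]
  have h : 0 < |cos x| := abs_pos.2 hx
  have h2 : 1 + sin x ≠ 0 := by
    intro h
    apply hx
    nlinarith [sin_sq_add_cos_sq x, sq_nonneg (cos x)]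
  have h3 : |cos x| * |cos x| = (1 - sin x) * (1 + sin x) := by
    rw [abs_mul_abs_self]; nlinarith [sin_sq_add_cos_sq x]
  field_simp
  nlinarith

theorem integral_abs_cos_div :
    ∫ x in (0 : ℝ)..π, |cos x| / (1 + sin x) = 2 * log 2 := by
  have hpos : ∀ x ∈ Set.Icc 0 π, 0 < 1 + sin x := fun x hx => by
    linarith [sin_nonneg_of_mem_Icc hx]
  have hcont : ContinuousOn (fun x => |cos x| / (1 + sin x)) (Set.Icc 0 π) :=
    ContinuousOn.div (by fun_prop) (by fun_prop) fun x hx => (hpos x hx).ne'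
  have hder : ∀ x ∈ Set.Icc 0 π, HasDerivAt (fun x => log (1 + sin x)) (cos x / (1 + sin x)) x :=
    fun x hx => ((hasDerivAt_sin x).const_add 1).log (hpos x hx).ne'
  have hp := pi_pos
  have hs1 : Set.uIcc 0 (π / 2) ⊆ Set.Icc 0 π := by
    rw [Set.uIcc_of_le (by linarith)]; exact Set.Icc_subset_Icc le_rfl (by linarith)
  have hs2 : Set.uIcc (π / 2) π ⊆ Set.Icc 0 π := by
    rw [Set.uIcc_of_le (by linarith)]; exact Set.Icc_subset_Icc (by linarith) le_rfl
  have h1 : ∫ x in (0 : ℝ)..(π / 2), |cos x| / (1 + sin x) = log 2 := by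
    rw [intervalIntegral.integral_eq_sub_of_hasDerivAt (f := fun x => log (1 + sin x))
      (fun x hx => ?_) (hcont.mono hs1).intervalIntegrable]
    · norm_num
    · have hx' := hx
      rw [Set.uIcc_of_le (by linarith)] at hx'
      rw [abs_of_nonneg (cos_nonneg_of_mem_Icc ⟨by linarith [hx'.1], hx'.2⟩)]
      exact hder x (hs1 hx)
  have h2 : ∫ x in (π / 2)..π, |cos x| / (1 + sin x) = log 2 := by
    rw [intervalIntegral.integral_eq_sub_of_hasDerivAt (f := fun x => -log (1 + sin x))
      (fun x hx => ?_) (hcont.mono hs2).intervalIntegrable]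
    · norm_num
    · have hx' := hx
      rw [Set.uIcc_of_le (by linarith)] at hx'
      rw [abs_of_nonpos (cos_nonpos_of_pi_div_two_le_of_le hx'.1 (by linarith [hx'.2])), neg_div]
      exact (hder x (hs2 hx)).neg
  rw [← intervalIntegral.integral_add_adjacent_intervals (hcont.mono hs1).intervalIntegrable
    (hcont.mono hs2).intervalIntegrable, h1, h2]
  ring

theorem sum_pi_mul_cbRatio_sq_sub (N : ℕ) :
    ∑ k ∈ range N, (π * cbRatio k ^ 2 - 2 / (2 * (k : ℝ) + 1)) =
      ∫ x in (0 : ℝ)..π, (∑ k ∈ range N, cbRatio k * (sin x ^ 2) ^ k) * (1 - sin x) := by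
  simp only [sum_mul]
  rw [intervalIntegral.integral_finsetSum
    fun k _ => Continuous.intervalIntegrable (by fun_prop) _ _]
  refine sum_congr rfl fun k _ => ?_
  have : ∀ x, cbRatio k * (sin x ^ 2) ^ k * (1 - sin x) =
      cbRatio k * sin x ^ (2 * k) - cbRatio k * sin x ^ (2 * k + 1) := fun x => by
    rw [pow_succ, pow_mul]; ring
  simp only [this]
  rw [intervalIntegral.integral_sub (Continuous.intervalIntegrable (by fun_prop) _ _)
    (Continuous.intervalIntegrable (by fun_prop) _ _), intervalIntegral.integral_const_mul,
    intervalIntegral.integral_const_mul, cbRatio_mul_integral_sin_pow_odd,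
    integral_sin_pow_even_eq_cbRatio]
  ring

theorem ae_cos_ne_zero_of_mem :
    ∀ᵐ x : ℝ, x ∈ Set.uIoc 0 π → cos x ≠ 0 := by
  have : ∀ᵐ x : ℝ, x ≠ π / 2 := by
    simp [MeasureTheory.ae_iff, MeasureTheory.measure_singleton]
  filter_upwards [this] with x hx hmem h0
  rw [Set.uIoc_of_le pi_pos.le] at hmem
  rcases lt_or_gt_of_ne hx with h | h
  · exact (cos_pos_of_mem_Ioo ⟨by linarith [hmem.1, pi_pos], h⟩).ne' h0
  · exact (cos_neg_of_pi_div_two_lt_of_lt h (by linarith [hmem.2, pi_pos])).ne h0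

theorem abs_sin_sq_lt_one {x : ℝ} (hx : cos x ≠ 0) : |sin x ^ 2| < 1 := by
  rw [abs_of_nonneg (sq_nonneg _), sin_sq]
  have : 0 < cos x ^ 2 := by positivity
  linarith

/-- Dominated convergence: the partial sums of the series of 1/√(1 - sin² x) are nonnegative and
increasing, and the limit times 1 - sin x is |cos x|/(1 + sin x) ≤ 1. The series is summed only off
x = π/2, a null set. -/
theorem tendsto_sum_pi_mul_cbRatio_sq_sub :
    Tendsto (fun N => ∑ k ∈ range N, (π * cbRatio k ^ 2 - 2 / (2 * (k : ℝ) + 1))) atTop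
      (nhds (2 * log 2)) := by
  simp only [sum_pi_mul_cbRatio_sq_sub]
  rw [← integral_abs_cos_div]
  refine intervalIntegral.tendsto_integral_filter_of_dominated_convergence (fun _ => (1 : ℝ))
    (Eventually.of_forall fun N => Continuous.aestronglyMeasurable (by fun_prop))
    (Eventually.of_forall fun N => ?_) intervalIntegrable_const ?_
  · filter_upwards [ae_cos_ne_zero_of_mem] with x hx hmem
    have hc := hx hmem
    rw [Set.uIoc_of_le pi_pos.le] at hmem
    have hs := sin_nonneg_of_mem_Icc ⟨hmem.1.le, hmem.2⟩
    have hs1 : 0 ≤ 1 - sin x := by linarith [sin_le_one x]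
    have hnn : ∀ k, 0 ≤ cbRatio k * (sin x ^ 2) ^ k := fun k =>
      mul_nonneg (cbRatio_pos k).le (by positivity)
    rw [norm_of_nonneg (mul_nonneg (sum_nonneg fun k _ => hnn k) hs1)]
    refine (mul_le_mul_of_nonneg_right (sum_le_hasSum _ (fun k _ => hnn k)
      (hasSum_cbRatio_mul_pow (abs_sin_sq_lt_one hc))) hs1).trans ?_
    rw [one_sub_sin_div_sqrt hc, div_le_one (by linarith)]
    linarith [abs_cos_le_one x]
  · filter_upwards [ae_cos_ne_zero_of_mem] with x hx hmem
    have hc := hx hmem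
    rw [← one_sub_sin_div_sqrt hc]
    exact ((hasSum_cbRatio_mul_pow (abs_sin_sq_lt_one hc)).tendsto_sum_nat).mul_const _

theorem sum_two_div_odd (N : ℕ) :
    ∑ k ∈ range N, 2 / (2 * (k : ℝ) + 1) = 2 * (harmonic (2 * N) : ℝ) - harmonic N := by
  induction N with
  | zero => simp
  | succ N ih =>
    rw [sum_range_succ, ih, show 2 * (N + 1) = 2 * N + 1 + 1 by ring, harmonic_succ,
      harmonic_succ, harmonic_succ]
    push_cast
    field_simp
    ring

/-- log 16 = 4 log 2 has two sources: 2 log 2 is the integral, and 2 log 2 comes from 2 log(2N) when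
∑ 2/(2k+1) = 2H_{2N} - H_N is compared with log N. -/
theorem tendsto_sum_pi_mul_cbRatio_sq_sub_log :
    Tendsto (fun N : ℕ => ∑ k ∈ range N, π * cbRatio k ^ 2 - log N) atTop
      (nhds (log 16 + eulerMascheroniConstant)) := by
  have h1 := tendsto_harmonic_sub_log
  have h2 : Tendsto (fun N : ℕ => (harmonic (2 * N) : ℝ) - log ((2 * N : ℕ) : ℝ)) atTop
      (nhds eulerMascheroniConstant) :=
    h1.comp (tendsto_id.const_mul_atTop' two_pos)
  have h3 := ((tendsto_sum_pi_mul_cbRatio_sq_sub.add (h2.const_mul 2)).sub h1).add_const (2 * log 2)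
  have e : 2 * log 2 + 2 * eulerMascheroniConstant - eulerMascheroniConstant + 2 * log 2 =
      log 16 + eulerMascheroniConstant := by
    rw [show (16 : ℝ) = 2 ^ 4 by norm_num, log_pow]; push_cast; ring
  rw [e] at h3
  refine h3.congr' ?_
  filter_upwards [eventually_gt_atTop 0] with N hN
  have hN' : (N : ℝ) ≠ 0 := by positivity
  rw [sum_sub_distrib, sum_two_div_odd]
  push_cast
  rw [log_mul two_ne_zero hN']
  ring

end CentralBinomialRatio

/-! ### Formal power series and the signs of their coefficients. -/

section FormalSeries

open PowerSeries Finset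

/-- `x tⁿ` becomes a monomial with nonnegative coefficient after `t ↦ i t`. -/
def AltCoeff (n : ℕ) (x : ℝ) : Prop := (Odd n → x = 0) ∧ ∀ k, n = 2 * k → 0 ≤ (-1) ^ k * x

theorem AltCoeff.zero (n : ℕ) : AltCoeff n 0 := by simp [AltCoeff]

theorem AltCoeff.add {n : ℕ} {x y : ℝ} (hx : AltCoeff n x) (hy : AltCoeff n y) :
    AltCoeff n (x + y) :=
  ⟨fun h => by rw [hx.1 h, hy.1 h, add_zero], fun k h => by
    rw [mul_add]; exact add_nonneg (hx.2 k h) (hy.2 k h)⟩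

theorem AltCoeff.mul {m n : ℕ} {x y : ℝ} (hx : AltCoeff m x) (hy : AltCoeff n y) :
    AltCoeff (m + n) (x * y) := by
  rcases Nat.even_or_odd' m with ⟨a, rfl | rfl⟩
  · rcases Nat.even_or_odd' n with ⟨b, rfl | rfl⟩
    · refine ⟨fun h => absurd h (by rw [← mul_add]; simp), fun k hk => ?_⟩
      obtain rfl : k = a + b := by omega
      have := mul_nonneg (hx.2 a rfl) (hy.2 b rfl)
      rw [pow_add]
      linarith
    · rw [hy.1 (by simp), mul_zero]; exact .zero _
  · rw [hx.1 (by simp), zero_mul]; exact .zero _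

theorem AltCoeff.const_mul {n : ℕ} {c x : ℝ} (hc : 0 ≤ c) (hx : AltCoeff n x) :
    AltCoeff n (c * x) := by
  simpa using AltCoeff.mul (m := 0) (x := c)
    ⟨by simp, fun k hk => by obtain rfl : k = 0 := by omega
                             simpa⟩ hx

theorem AltCoeff.of_const_mul {n : ℕ} {c x : ℝ} (hc : 0 < c) (hx : AltCoeff n (c * x)) :
    AltCoeff n x := by
  have := hx.const_mul (inv_nonneg.2 hc.le)
  rwa [inv_mul_cancel_left₀ hc.ne'] at this

theorem AltCoeff.sum {ι : Type*} {n : ℕ} {s : Finset ι} {f : ι → ℝ}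
    (h : ∀ i ∈ s, AltCoeff n (f i)) : AltCoeff n (∑ i ∈ s, f i) := by
  classical
  induction s using Finset.induction_on with
  | empty => simpa using AltCoeff.zero n
  | insert a s ha ih =>
    rw [sum_insert ha]
    exact (h a (mem_insert_self _ _)).add (ih fun i hi => h i (mem_insert_of_mem hi))

/-- A series which gets nonnegative coefficients and is even after `t ↦ i t`. -/
def AltSeries (P : ℝ⟦X⟧) : Prop := ∀ n, AltCoeff n (coeff n P)

/-- The vanishing alternatives serve strong inductions: a factor with zero constant term removes the
index n for which nothing is known yet. -/
theorem AltCoeff.coeff_mul {n : ℕ} {P Q : ℝ⟦X⟧}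
    (h : ∀ i j, i + j = n → AltCoeff i (coeff i P) ∧ AltCoeff j (coeff j Q) ∨
      coeff i P = 0 ∨ coeff j Q = 0) :
    AltCoeff n (coeff n (P * Q)) := by
  rw [PowerSeries.coeff_mul]
  refine AltCoeff.sum fun p hp => ?_
  rw [HasAntidiagonal.mem_antidiagonal] at hp
  rcases h p.1 p.2 hp with h | h | h
  · rw [← hp]; exact h.1.mul h.2
  · rw [h, zero_mul]; exact .zero _
  · rw [h, mul_zero]; exact .zero _

theorem AltSeries.mul {P Q : ℝ⟦X⟧} (hP : AltSeries P) (hQ : AltSeries Q) : AltSeries (P * Q) :=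
  fun _ => AltCoeff.coeff_mul fun i j _ => .inl ⟨hP i, hQ j⟩

theorem AltCoeff.neg_shift_two {n : ℕ} {x : ℝ} (h : AltCoeff n x) : AltCoeff (n + 2) (-x) := by
  have : AltCoeff 2 (-1) := ⟨by simp, fun k hk => by obtain rfl : k = 1 := by omega
                                                     simp⟩
  simpa using h.mul this

theorem AltCoeff.neg_X_sq_mul {n : ℕ} {P : ℝ⟦X⟧} (h : ∀ m, m + 2 = n → AltCoeff m (coeff m P)) :
    AltCoeff n (-coeff n (X ^ 2 * P)) := by
  rw [coeff_X_pow_mul']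
  split_ifs with h2
  · obtain ⟨m, rfl⟩ := Nat.exists_eq_add_of_le' h2
    simpa using (h m rfl).neg_shift_two
  · simpa using AltCoeff.zero n

/-- The formal series of `exp (a t)`. -/
noncomputable def expSeries (a : ℝ) : ℝ⟦X⟧ := rescale a (exp ℝ)

theorem expSeries_mul (a b : ℝ) : expSeries a * expSeries b = expSeries (a + b) :=
  exp_mul_exp_eq_exp_add a b

theorem coeff_expSeries (a : ℝ) (n : ℕ) : coeff n (expSeries a) = a ^ n / n.factorial := by
  simp [expSeries, coeff_rescale, coeff_exp, div_eq_mul_inv]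

theorem expSeries_zero : expSeries 0 = 1 := by
  ext n
  rw [coeff_expSeries, coeff_one]
  rcases n with _ | n <;> simp

theorem derivative_expSeries (a : ℝ) : d⁄dX ℝ (expSeries a) = C a * expSeries a := by
  ext n
  rw [coeff_derivative, coeff_C_mul, coeff_expSeries, coeff_expSeries, Nat.factorial_succ]
  push_cast
  field_simp
  ring

/-- With this relation `C (1 / 4)` can be treated as an atom by `linear_combination`; this is why
1/2 is written `C (1 / 4) * 2` below. -/
theorem four_mul_C_quarter : (4 : ℝ⟦X⟧) * C (1 / 4 : ℝ) = 1 := by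
  rw [show (4 : ℝ⟦X⟧) = C (4 : ℝ) from (map_ofNat C 4).symm, ← map_mul]
  norm_num

/-- The formal series of `cosh (t/4)`. -/
noncomputable def coshSeries : ℝ⟦X⟧ :=
  C (1 / 4 : ℝ) * 2 * (expSeries (1 / 4) + expSeries (-(1 / 4)))

/-- The formal series of `sinh (t/4)`. -/
noncomputable def sinhSeries : ℝ⟦X⟧ :=
  C (1 / 4 : ℝ) * 2 * (expSeries (1 / 4) - expSeries (-(1 / 4)))

/-- The formal series of `sinh (t/4) / (t/4)`. -/
noncomputable def sinhcSeries : ℝ⟦X⟧ := .mk fun n => 4 * coeff (n + 1) sinhSeries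

/-- The formal series of `(t/4) / sinh (t/4)`. -/
noncomputable def cschSeries : ℝ⟦X⟧ := sinhcSeries⁻¹

/-- The formal series of `1 / cosh (t/4)`. -/
noncomputable def sechSeries : ℝ⟦X⟧ := coshSeries⁻¹

/-- The formal series of `tanh (t/4) / (t/4)`. -/
noncomputable def tanhcSeries : ℝ⟦X⟧ := sinhcSeries * sechSeries

/-- The formal series of `1 - (t/4) coth (t/4)`. -/
noncomputable def cothSeries : ℝ⟦X⟧ := 1 - coshSeries * cschSeries

theorem exp_quarter_mul_exp_neg_quarter : expSeries (1 / 4) * expSeries (-(1 / 4)) = 1 := by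
  rw [expSeries_mul, add_neg_cancel, expSeries_zero]

theorem coshSeries_sq_sub_sinhSeries_sq : coshSeries ^ 2 - sinhSeries ^ 2 = 1 := by
  have h1 := exp_quarter_mul_exp_neg_quarter
  have h2 := four_mul_C_quarter
  rw [coshSeries, sinhSeries]
  linear_combination (16 * C (1 / 4 : ℝ) ^ 2) * h1 + (4 * C (1 / 4 : ℝ) + 1) * h2

theorem derivative_C_mul (a : ℝ) (P : ℝ⟦X⟧) : d⁄dX ℝ (C a * P) = C a * d⁄dX ℝ P := by
  rw [← smul_eq_C_mul, Derivation.map_smul, smul_eq_C_mul]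

theorem derivative_coshSeries : d⁄dX ℝ coshSeries = C (1 / 4 : ℝ) * sinhSeries := by
  rw [coshSeries, sinhSeries, mul_assoc, derivative_C_mul, two_mul, map_add, map_add,
    derivative_expSeries, derivative_expSeries, map_neg]
  ring

theorem derivative_sinhSeries : d⁄dX ℝ sinhSeries = C (1 / 4 : ℝ) * coshSeries := by
  rw [coshSeries, sinhSeries, mul_assoc, derivative_C_mul, two_mul, map_add, map_sub,
    derivative_expSeries, derivative_expSeries, map_neg]
  ring

theorem constantCoeff_coshSeries : constantCoeff coshSeries = 1 := by
  rw [← coeff_zero_eq_constantCoeff_apply, coshSeries, mul_assoc, coeff_C_mul, two_mul]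
  simp only [map_add, coeff_expSeries]
  norm_num

theorem sinhSeries_eq : sinhSeries = C (1 / 4 : ℝ) * (X * sinhcSeries) := by
  ext n
  rw [coeff_C_mul]
  rcases n with _ | n
  · rw [coeff_zero_X_mul, sinhSeries, mul_assoc, coeff_C_mul, two_mul]
    simp only [map_add, map_sub, coeff_expSeries]
    simp
  · rw [coeff_succ_X_mul, sinhcSeries, coeff_mk]
    ring

theorem constantCoeff_sinhcSeries : constantCoeff sinhcSeries = 1 := by
  rw [← coeff_zero_eq_constantCoeff_apply, sinhcSeries, coeff_mk, sinhSeries, mul_assoc,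
    coeff_C_mul, two_mul]
  simp only [map_add, map_sub, coeff_expSeries]
  norm_num

theorem sinhcSeries_mul_cschSeries : sinhcSeries * cschSeries = 1 :=
  PowerSeries.mul_inv_cancel _ (by rw [constantCoeff_sinhcSeries]; exact one_ne_zero)

theorem coshSeries_mul_sechSeries : coshSeries * sechSeries = 1 :=
  PowerSeries.mul_inv_cancel _ (by rw [constantCoeff_coshSeries]; exact one_ne_zero)

theorem constantCoeff_cschSeries : constantCoeff cschSeries = 1 := by
  have := congrArg constantCoeff sinhcSeries_mul_cschSeries
  simpa [constantCoeff_sinhcSeries] using this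

theorem constantCoeff_sechSeries : constantCoeff sechSeries = 1 := by
  have := congrArg constantCoeff coshSeries_mul_sechSeries
  simpa [constantCoeff_coshSeries] using this

theorem coeff_zero_cothSeries : coeff 0 cothSeries = 0 := by
  simp [cothSeries, constantCoeff_coshSeries, constantCoeff_cschSeries]

/-! ### Differential equations of the hyperbolic series, and the recursions they give. -/

theorem X_mul_derivative_sinhcSeries :
    X * d⁄dX ℝ sinhcSeries = coshSeries - sinhcSeries := by
  have h := derivative_sinhSeries
  rw [sinhSeries_eq, derivative_C_mul, Derivation.leibniz, derivative_X, smul_eq_mul,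
    smul_eq_mul] at h
  linear_combination 4 * h + (coshSeries - sinhcSeries - X * d⁄dX ℝ sinhcSeries) *
    four_mul_C_quarter

theorem X_mul_derivative_cschSeries :
    X * d⁄dX ℝ cschSeries = cschSeries * cothSeries := by
  rw [cschSeries, derivative_inv', ← cschSeries, cothSeries]
  linear_combination -cschSeries ^ 2 * X_mul_derivative_sinhcSeries +
    cschSeries * sinhcSeries_mul_cschSeries

theorem X_mul_derivative_cothSeries :
    X * d⁄dX ℝ cothSeries = C (1 / 16 : ℝ) * (-X ^ 2) + cothSeries ^ 2 - cothSeries := by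
  have h16 : C (1 / 16 : ℝ) = C (1 / 4 : ℝ) * C (1 / 4 : ℝ) := by rw [← map_mul]; norm_num
  have e : X * d⁄dX ℝ cothSeries = - (X * d⁄dX ℝ coshSeries) * cschSeries -
      coshSeries * (X * d⁄dX ℝ cschSeries) := by
    rw [cothSeries, map_sub, derivative_one, Derivation.leibniz, smul_eq_mul, smul_eq_mul]
    ring
  rw [e, derivative_coshSeries, X_mul_derivative_cschSeries, sinhSeries_eq, h16, cothSeries]
  linear_combination -X ^ 2 * C (1 / 4 : ℝ) ^ 2 * sinhcSeries_mul_cschSeries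

theorem X_mul_derivative_sechSeries :
    X * d⁄dX ℝ sechSeries = C (1 / 16 : ℝ) * (-(X ^ 2 * (tanhcSeries * sechSeries))) := by
  have h16 : C (1 / 16 : ℝ) = C (1 / 4 : ℝ) * C (1 / 4 : ℝ) := by rw [← map_mul]; norm_num
  rw [sechSeries, derivative_inv', ← sechSeries, tanhcSeries, derivative_coshSeries, sinhSeries_eq,
    h16]
  ring

theorem tanhcSeries_add_X_mul_derivative :
    tanhcSeries + X * d⁄dX ℝ tanhcSeries =
      1 + C (1 / 16 : ℝ) * (-(X ^ 2 * (tanhcSeries * tanhcSeries))) := by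
  have e : X * d⁄dX ℝ tanhcSeries = (X * d⁄dX ℝ sinhcSeries) * sechSeries +
      sinhcSeries * (X * d⁄dX ℝ sechSeries) := by
    rw [tanhcSeries, Derivation.leibniz, smul_eq_mul, smul_eq_mul]
    ring
  rw [e, X_mul_derivative_sechSeries, X_mul_derivative_sinhcSeries, tanhcSeries]
  linear_combination coshSeries_mul_sechSeries

theorem coeff_X_mul_derivative (P : ℝ⟦X⟧) (n : ℕ) :
    coeff n (X * d⁄dX ℝ P) = n * coeff n P := by
  rcases n with _ | n
  · simp
  · rw [coeff_succ_X_mul, coeff_derivative]; push_cast; ring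

theorem altSeries_one : AltSeries 1 := by
  intro n
  rw [coeff_one]
  split_ifs with h
  · subst h
    exact ⟨by simp, fun k hk => by obtain rfl : k = 0 := by omega
                                   simp⟩
  · exact .zero n

/-- The Riccati equation tD' + D = -t²/16 + D² expresses (n+1) D_n through lower coefficients, D_0
being zero, and each term on the right has the required sign. -/
theorem altSeries_cothSeries : AltSeries cothSeries := by
  intro n
  induction n using Nat.strong_induction_on with
  | _ n ih =>
    have h := congrArg (coeff n) X_mul_derivative_cothSeries
    rw [coeff_X_mul_derivative, map_sub, map_add, coeff_C_mul, map_neg, sq cothSeries] at h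
    refine AltCoeff.of_const_mul (c := n + 1) (by positivity) ?_
    rw [show ((n : ℝ) + 1) * coeff n cothSeries =
      1 / 16 * -coeff n (X ^ 2 * 1 : ℝ⟦X⟧) + coeff n (cothSeries * cothSeries) by
        rw [mul_one]; linarith]
    refine ((AltCoeff.neg_X_sq_mul fun m _ => altSeries_one m).const_mul (by norm_num)).add
      (AltCoeff.coeff_mul fun i j hij => ?_)
    rcases Nat.eq_zero_or_pos i with rfl | hi
    · exact .inr (.inl coeff_zero_cothSeries)
    · rcases Nat.eq_zero_or_pos j with rfl | hj
      · exact .inr (.inr coeff_zero_cothSeries)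
      · exact .inl ⟨ih i (by omega), ih j (by omega)⟩

theorem altSeries_cschSeries : AltSeries cschSeries := by
  intro n
  induction n using Nat.strong_induction_on with
  | _ n ih =>
    rcases Nat.eq_zero_or_pos n with rfl | hn
    · rw [coeff_zero_eq_constantCoeff_apply, constantCoeff_cschSeries]
      simpa using altSeries_one 0
    have h := congrArg (coeff n) X_mul_derivative_cschSeries
    rw [coeff_X_mul_derivative] at h
    refine AltCoeff.of_const_mul (c := n) (by positivity) ?_
    rw [h]
    refine AltCoeff.coeff_mul fun i j hij => ?_
    rcases Nat.eq_zero_or_pos j with rfl | hj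
    · exact .inr (.inr coeff_zero_cothSeries)
    · exact .inl ⟨ih i (by omega), altSeries_cothSeries j⟩

theorem altSeries_tanhcSeries : AltSeries tanhcSeries := by
  intro n
  induction n using Nat.strong_induction_on with
  | _ n ih =>
    have h := congrArg (coeff n) tanhcSeries_add_X_mul_derivative
    rw [map_add, map_add, coeff_X_mul_derivative, coeff_C_mul, map_neg] at h
    refine AltCoeff.of_const_mul (c := n + 1) (by positivity) ?_
    rw [add_one_mul, add_comm, h]
    exact (altSeries_one n).add ((AltCoeff.neg_X_sq_mul fun m hm =>
      AltCoeff.coeff_mul fun i j hij => .inl ⟨ih i (by omega), ih j (by omega)⟩).const_mul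
        (by norm_num))

theorem altSeries_sechSeries : AltSeries sechSeries := by
  intro n
  induction n using Nat.strong_induction_on with
  | _ n ih =>
    rcases Nat.eq_zero_or_pos n with rfl | hn
    · rw [coeff_zero_eq_constantCoeff_apply, constantCoeff_sechSeries]
      simpa using altSeries_one 0
    have h := congrArg (coeff n) X_mul_derivative_sechSeries
    rw [coeff_X_mul_derivative, coeff_C_mul, map_neg] at h
    refine AltCoeff.of_const_mul (c := n) (by positivity) ?_
    rw [h]
    exact (AltCoeff.neg_X_sq_mul fun m hm => AltCoeff.coeff_mul fun i j hij =>
      .inl ⟨altSeries_tanhcSeries i, ih j (by omega)⟩).const_mul (by norm_num)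

/-! ### The Legendre factor. -/

/-- The formal series of `1 - (t/2) coth (t/2)`. -/
noncomputable def cothDoubleSeries : ℝ⟦X⟧ :=
  cothSeries + C (1 / 16 : ℝ) * (-(X ^ 2 * tanhcSeries))

/-- Duplication, 2 coth 2x = coth x + tanh x, reduces the sign to the two series already treated. -/
theorem altSeries_cothDoubleSeries : AltSeries cothDoubleSeries := fun n => by
  rw [cothDoubleSeries, map_add, coeff_C_mul, map_neg]
  exact (altSeries_cothSeries n).add
    ((AltCoeff.neg_X_sq_mul fun m _ => altSeries_tanhcSeries m).const_mul (by norm_num))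

theorem coeff_zero_cothDoubleSeries : coeff 0 cothDoubleSeries = 0 := by
  rw [cothDoubleSeries, map_add, coeff_zero_cothSeries, coeff_C_mul]
  simp

/-- The Taylor coefficients of `P_{-1/2}(cosh (t/2))`. -/
noncomputable def legendreCoeff : ℕ → ℝ
  | 0 => 1
  | n + 1 => (∑ i : Fin (n + 1), (coeff (n + 1 - i) cothDoubleSeries * i -
      if n + 1 = i + 2 then 1 / 16 else 0) * legendreCoeff i) / ((n : ℝ) + 1) ^ 2

/-- The formal series of `P_{-1/2}(cosh (t/2))`. -/
noncomputable def legendreSeries : ℝ⟦X⟧ := .mk legendreCoeff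

theorem coeff_zero_legendreSeries : coeff 0 legendreSeries = 1 := by
  simp [legendreSeries, legendreCoeff]

theorem sq_mul_coeff_legendreSeries (n : ℕ) :
    (n : ℝ) ^ 2 * coeff n legendreSeries =
      coeff n (cothDoubleSeries * (X * d⁄dX ℝ legendreSeries)) +
        1 / 16 * -coeff n (X ^ 2 * legendreSeries) := by
  rcases n with _ | n
  · simp
  rw [legendreSeries, coeff_mk, legendreCoeff]
  have hn : ((n : ℝ) + 1) ^ 2 ≠ 0 := by positivity
  rw [Nat.cast_succ, mul_div_cancel₀ _ hn, PowerSeries.coeff_mul,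
    Fin.sum_univ_eq_sum_range (fun i => (coeff (n + 1 - i) cothDoubleSeries * (i : ℝ) -
      if n + 1 = i + 2 then 1 / 16 else 0) * legendreCoeff i),
    ← Nat.sum_antidiagonal_swap, Nat.sum_antidiagonal_eq_sum_range_succ_mk,
    Nat.succ_eq_add_one, sum_range_succ _ (n + 1)]
  simp only [Prod.fst_swap, Prod.snd_swap, tsub_self, coeff_zero_cothDoubleSeries, zero_mul,
    add_zero, coeff_X_mul_derivative, coeff_mk, sub_mul, sum_sub_distrib]
  rw [sub_eq_add_neg]
  congr 1
  · exact sum_congr rfl fun i _ => by ring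
  · rw [coeff_X_pow_mul', mul_neg]
    congr 1
    rcases n with _ | n
    · simp
    · rw [if_pos (by omega), coeff_mk, sum_eq_single n]
      · simp
      · intro b _ hb
        rw [if_neg (by omega), zero_mul]
      · simp

/-- Legendre's equation of degree -1/2 in z = cosh(t/2), multiplied by t² and written with the Euler
operator t d/dt. -/
theorem legendreSeries_ode_theta :
    X * d⁄dX ℝ (X * d⁄dX ℝ legendreSeries) =
      cothDoubleSeries * (X * d⁄dX ℝ legendreSeries) +
        C (1 / 16 : ℝ) * (-(X ^ 2 * legendreSeries)) := by
  ext n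
  rw [coeff_X_mul_derivative, coeff_X_mul_derivative, map_add, coeff_C_mul, map_neg,
    ← sq_mul_coeff_legendreSeries]
  ring

theorem altSeries_legendreSeries : AltSeries legendreSeries := by
  intro n
  induction n using Nat.strong_induction_on with
  | _ n ih =>
    rcases Nat.eq_zero_or_pos n with rfl | hn
    · rw [coeff_zero_legendreSeries]
      simpa using altSeries_one 0
    refine AltCoeff.of_const_mul (c := (n : ℝ) ^ 2) (by positivity) ?_
    rw [sq_mul_coeff_legendreSeries]
    refine AltCoeff.add (AltCoeff.coeff_mul fun i j hij => ?_)
      ((AltCoeff.neg_X_sq_mul fun m hm => ih m (by omega)).const_mul (by norm_num))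
    rcases Nat.eq_zero_or_pos i with rfl | hi
    · exact .inr (.inl coeff_zero_cothDoubleSeries)
    · rw [coeff_X_mul_derivative]
      exact .inl ⟨altSeries_cothDoubleSeries i, (ih j (by omega)).const_mul (by positivity)⟩

/-- Strictness comes from the term -(t²/16)P alone, which feeds the previous even coefficient into
the next; the other term is only nonnegative. -/
theorem coeff_legendreSeries_pos (k : ℕ) : 0 < (-1) ^ k * coeff (2 * k) legendreSeries := by
  induction k with
  | zero => simp [coeff_zero_legendreSeries]
  | succ k ih =>
    have h := sq_mul_coeff_legendreSeries (2 * (k + 1))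
    have h1 : AltCoeff (2 * (k + 1))
        (coeff (2 * (k + 1)) (cothDoubleSeries * (X * d⁄dX ℝ legendreSeries))) :=
      altSeries_cothDoubleSeries.mul (fun j => by
        rw [coeff_X_mul_derivative]
        exact (altSeries_legendreSeries j).const_mul (by positivity)) _
    have h2 := h1.2 (k + 1) rfl
    rw [show coeff (2 * (k + 1)) (X ^ 2 * legendreSeries) = coeff (2 * k) legendreSeries by
      rw [mul_add, mul_one, coeff_X_pow_mul]] at h
    have h3 : 0 < ((2 * (k + 1) : ℕ) : ℝ) ^ 2 *
        ((-1) ^ (k + 1) * coeff (2 * (k + 1)) legendreSeries) := by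
      rw [mul_left_comm, h, mul_add]
      have : (-1 : ℝ) ^ (k + 1) * (1 / 16 * -coeff (2 * k) legendreSeries) =
        1 / 16 * ((-1) ^ k * coeff (2 * k) legendreSeries) := by ring
      rw [this]
      positivity
    exact pos_of_mul_pos_right h3 (by positivity)

theorem coeff_legendreSeries_mul_pos {P : ℝ⟦X⟧} (hP : AltSeries P) (h0 : coeff 0 P = 1) (k : ℕ) :
    0 < (-1) ^ k * coeff (2 * k) (legendreSeries * P) := by
  rw [PowerSeries.coeff_mul, mul_sum]
  refine sum_pos' (fun p hp => ?_) ⟨(2 * k, 0), by simp, ?_⟩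
  · rw [HasAntidiagonal.mem_antidiagonal] at hp
    exact ((altSeries_legendreSeries p.1).mul (hP p.2)).2 k hp
  · rw [h0, mul_one]
    exact coeff_legendreSeries_pos k

/-! ### The Landau series, its signs, and the equations for the Borel transforms. -/

/-- The formal series of `t P_{-1/2}(cosh (t/2)) e^{t/4} / (2 sinh (t/2))`. -/
noncomputable def landauSeries : ℝ⟦X⟧ :=
  legendreSeries * (cschSeries + C (1 / 4 : ℝ) * (X * sechSeries))

theorem coeff_zero_landauSeries : coeff 0 landauSeries = 1 := by
  have := coeff_zero_legendreSeries
  rw [coeff_zero_eq_constantCoeff_apply] at this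
  simp [landauSeries, this, constantCoeff_cschSeries]

theorem coeff_succ_landauSeries (l : ℕ) :
    coeff (l + 1) landauSeries = coeff (l + 1) (legendreSeries * cschSeries) +
      1 / 4 * coeff l (legendreSeries * sechSeries) := by
  rw [landauSeries, mul_add, map_add, show legendreSeries * (C (1 / 4 : ℝ) * (X * sechSeries)) =
    C (1 / 4 : ℝ) * (X * (legendreSeries * sechSeries)) by ring, coeff_C_mul, coeff_succ_X_mul]

/-- The csch part is even and the sech part odd, so exactly one contributes to each coefficient. The
exponent l(l+1)/2 has the parity of k for l = 2k and of k + 1 for l = 2k + 1. -/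
theorem sign_coeff_landauSeries (l : ℕ) :
    0 < (-1 : ℝ) ^ (l * (l + 1) / 2) * coeff (l + 1) landauSeries := by
  rw [coeff_succ_landauSeries]
  have hcsch := altSeries_legendreSeries.mul altSeries_cschSeries
  have hsech := altSeries_legendreSeries.mul altSeries_sechSeries
  rcases Nat.even_or_odd' l with ⟨k, rfl | rfl⟩
  · rw [(hcsch (2 * k + 1)).1 (by simp), zero_add,
      show 2 * k * (2 * k + 1) / 2 = k + 2 * (k * k) by
        rw [mul_assoc, Nat.mul_div_cancel_left _ two_pos]; ring, pow_add, pow_mul]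
    have := coeff_legendreSeries_mul_pos altSeries_sechSeries
      (by simpa using constantCoeff_sechSeries) k
    norm_num
    linarith
  · rw [(hsech (2 * k + 1)).1 (by simp), mul_zero, add_zero,
      show (2 * k + 1) * (2 * k + 1 + 1) / 2 = (k + 1) + 2 * (k * (k + 1)) by
        rw [show (2 * k + 1) * (2 * k + 1 + 1) = 2 * ((k + 1) + 2 * (k * (k + 1))) by ring,
          Nat.mul_div_cancel_left _ two_pos], pow_add, pow_mul]
    have := coeff_legendreSeries_mul_pos altSeries_cschSeries
      (by simpa using constantCoeff_cschSeries) (k + 1)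
    norm_num
    exact this

/-- The formal Borel transform `e^{-t/4} P_{-1/2}(cosh (t/2))` of `π c_N²`. -/
noncomputable def termSeries : ℝ⟦X⟧ := expSeries (-(1 / 4)) * legendreSeries

theorem coeff_zero_termSeries : coeff 0 termSeries = 1 := by
  have h := coeff_zero_legendreSeries
  have h2 := coeff_expSeries (-(1 / 4)) 0
  rw [coeff_zero_eq_constantCoeff_apply] at h h2 ⊢
  rw [termSeries, map_mul, h, h2]
  simp

theorem expSeries_neg_one : expSeries (-1) = expSeries (-(1 / 4)) ^ 4 := by
  rw [pow_succ, pow_succ, sq, expSeries_mul, expSeries_mul, expSeries_mul]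
  norm_num

theorem legendreSeries_ode :
    (1 - expSeries (-1)) * (d⁄dX ℝ (d⁄dX ℝ legendreSeries) + C (1 / 4 : ℝ) ^ 2 * legendreSeries) +
      2 * C (1 / 4 : ℝ) * (1 + expSeries (-1)) * d⁄dX ℝ legendreSeries = 0 := by
  have h16 : C (1 / 16 : ℝ) = C (1 / 4 : ℝ) * C (1 / 4 : ℝ) := by rw [← map_mul]; norm_num
  have h4 := four_mul_C_quarter
  have hode := legendreSeries_ode_theta
  rw [Derivation.leibniz, derivative_X, smul_eq_mul, smul_eq_mul, h16, cothDoubleSeries,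
    h16, cothSeries, tanhcSeries] at hode
  have hee := exp_quarter_mul_exp_neg_quarter
  have hsh : sinhSeries * cschSeries = C (1 / 4 : ℝ) * X := by
    rw [sinhSeries_eq]
    linear_combination C (1 / 4 : ℝ) * X * sinhcSeries_mul_cschSeries
  have hshc := sinhSeries_eq
  have hch := coshSeries_mul_sechSeries
  have hm : expSeries (-1) = (coshSeries - sinhSeries) ^ 4 := by
    rw [expSeries_neg_one, coshSeries, sinhSeries]
    linear_combination (-expSeries (-(1 / 4)) ^ 4) * (64 * C (1 / 4 : ℝ) ^ 3 +
      16 * C (1 / 4 : ℝ) ^ 2 + 4 * C (1 / 4 : ℝ) + 1) * h4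
  have hsq := coshSeries_sq_sub_sinhSeries_sq
  have hX : (X : ℝ⟦X⟧) ≠ 0 := X_ne_zero
  -- From here on only polynomial identities between independent atoms are needed.
  generalize expSeries (-1) = q at *
  generalize coshSeries = ch at *
  generalize sinhSeries = sh at *
  generalize sinhcSeries = σ at *
  generalize cschSeries = S at *
  generalize sechSeries = T at *
  generalize C (1 / 4 : ℝ) = κ at *
  generalize d⁄dX ℝ (d⁄dX ℝ legendreSeries) = E2 at *
  generalize d⁄dX ℝ legendreSeries = E1 at *
  generalize legendreSeries = E at *
  apply mul_left_cancel₀ (pow_ne_zero 2 hX)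
  -- Multiplying by sinh · cosh clears the denominators of coth and tanh.
  have hode' : X ^ 2 * (E2 + κ ^ 2 * E) * (sh * ch) + κ * X ^ 2 * (ch ^ 2 + sh ^ 2) * E1 = 0 := by
    have e1 : sh * ch * (ch * S) = κ * X * ch ^ 2 := by linear_combination ch ^ 2 * hsh
    have e2 : sh * ch * (κ ^ 2 * X ^ 2 * (σ * T)) = κ * X * sh ^ 2 := by
      linear_combination sh * κ ^ 2 * X ^ 2 * σ * hch - sh * κ * X * hshc
    linear_combination sh * ch * hode - X * E1 * e1 - X * E1 * e2
  have hq1 : 1 - q = 4 * (ch - sh) ^ 2 * (sh * ch) := by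
    rw [hm]
    linear_combination (-(ch ^ 2 - sh ^ 2) - 1) * hsq
  have hq2 : 1 + q = 2 * (ch - sh) ^ 2 * (ch ^ 2 + sh ^ 2) := by
    rw [hm]
    linear_combination (-(ch ^ 2 - sh ^ 2) - 1) * hsq
  rw [hq1, hq2]
  linear_combination 4 * (ch - sh) ^ 2 * hode'

/-- The Borel image of (N+1)² a_{N+1} = (N² + N + 1/4) a_N; it is the Legendre equation conjugated
by e^{-t/4}. -/
theorem termSeries_ode :
    expSeries (-1) * d⁄dX ℝ (d⁄dX ℝ termSeries) =
      d⁄dX ℝ (d⁄dX ℝ termSeries) + d⁄dX ℝ termSeries + C (1 / 4 : ℝ) * termSeries := by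
  have h4 := four_mul_C_quarter
  have h := legendreSeries_ode
  rw [termSeries]
  simp only [Derivation.leibniz, map_add, smul_eq_mul, derivative_expSeries, map_neg, derivative_C, neg_mul, mul_neg, mul_zero]
  linear_combination -expSeries (-(1 / 4)) * h +
    expSeries (-(1 / 4)) * d⁄dX ℝ legendreSeries * h4

theorem one_sub_exp_mul_landauSeries :
    (1 - expSeries (-1)) * landauSeries = X * termSeries := by
  have h4 := four_mul_C_quarter
  have hsh : sinhSeries * cschSeries = C (1 / 4 : ℝ) * X := by
    rw [sinhSeries_eq]
    linear_combination C (1 / 4 : ℝ) * X * sinhcSeries_mul_cschSeries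
  have hch := coshSeries_mul_sechSeries
  have hp : expSeries (1 / 4) = coshSeries + sinhSeries := by
    rw [coshSeries, sinhSeries]
    linear_combination -expSeries (1 / 4) * h4
  have hm : expSeries (-(1 / 4)) = coshSeries - sinhSeries := by
    rw [coshSeries, sinhSeries]
    linear_combination -expSeries (-(1 / 4)) * h4
  have hsq := coshSeries_sq_sub_sinhSeries_sq
  have hq1 : 1 - expSeries (-1) =
      4 * (coshSeries - sinhSeries) ^ 2 * (sinhSeries * coshSeries) := by
    rw [expSeries_neg_one, hm]
    linear_combination (-(coshSeries ^ 2 - sinhSeries ^ 2) - 1) * hsq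
  rw [hq1, landauSeries, termSeries, hm]
  linear_combination 4 * (coshSeries - sinhSeries) ^ 2 * coshSeries * legendreSeries * hsh +
    4 * C (1 / 4 : ℝ) * (coshSeries - sinhSeries) ^ 2 * sinhSeries * legendreSeries * X * hch +
    (coshSeries - sinhSeries) ^ 2 * (coshSeries + sinhSeries) * legendreSeries * X * h4 +
    (coshSeries - sinhSeries) * legendreSeries * X * hsq

/-- The formal Borel transform of `π G_{N-1} - log (16 N) - γ`. -/
noncomputable def borelSeries : ℝ⟦X⟧ := .mk fun n => -coeff (n + 1) landauSeries

/-- The formal Borel transform `(1 - e^{-t}) / t` of `log (N + 1) - log N`. -/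
noncomputable def logStepSeries : ℝ⟦X⟧ := .mk fun n => (-1) ^ n / (n + 1).factorial

theorem X_mul_borelSeries : X * borelSeries = 1 - landauSeries := by
  ext n
  rcases n with _ | n
  · have := coeff_zero_landauSeries
    rw [coeff_zero_X_mul, map_sub, this]
    simp
  · rw [coeff_succ_X_mul, borelSeries, coeff_mk, map_sub, coeff_one, if_neg (by omega), zero_sub]

theorem X_mul_logStepSeries : X * logStepSeries = 1 - expSeries (-1) := by
  ext n
  rw [map_sub, coeff_expSeries]
  rcases n with _ | n
  · simp
  · rw [coeff_succ_X_mul, logStepSeries, coeff_mk, coeff_one, if_neg (by omega), pow_succ]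
    ring

/-- The Borel image of a_N = (log(N+1) - log N) + (R_{N+1} - R_N), with R the remainder of the
Landau sum. -/
theorem termSeries_eq :
    termSeries = logStepSeries + (expSeries (-1) - 1) * borelSeries := by
  apply mul_left_cancel₀ (X_ne_zero (R := ℝ))
  linear_combination -one_sub_exp_mul_landauSeries - X_mul_logStepSeries -
    (expSeries (-1) - 1) * X_mul_borelSeries

end FormalSeries

/-! ### Asymptotic calculus of formal Laplace transforms. -/

section BorelExpansion

open PowerSeries Finset

/-- The partial sum `∑_{k<L} k! B_k / N^{k+1}` of the formal Laplace transform of `B`. -/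
noncomputable def borelSum (L : ℕ) (B : ℝ⟦X⟧) (N : ℝ) : ℝ :=
  ∑ k ∈ range L, k.factorial * coeff k B / N ^ (k + 1)

/-- `g` agrees with the formal Laplace transform of `B` up to `O(N^{-L-1})`. -/
def BorelTo (L : ℕ) (g : ℕ → ℝ) (B : ℝ⟦X⟧) : Prop :=
  (fun N : ℕ => g N - borelSum L B N) =O[atTop] fun N : ℕ => 1 / (N : ℝ) ^ (L + 1)

theorem BorelTo.add {L : ℕ} {g h : ℕ → ℝ} {B B' : ℝ⟦X⟧} (hg : BorelTo L g B)
    (hh : BorelTo L h B') : BorelTo L (fun N => g N + h N) (B + B') := by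
  refine (IsBigO.add hg hh).congr_left fun N => ?_
  simp only [borelSum, map_add, mul_add, add_div, sum_add_distrib]
  ring

theorem BorelTo.const_mul {L : ℕ} {g : ℕ → ℝ} {B : ℝ⟦X⟧} (c : ℝ) (hg : BorelTo L g B) :
    BorelTo L (fun N => c * g N) (C c * B) := by
  refine (IsBigO.const_mul_left hg c).congr_left fun N => ?_
  simp only [borelSum, coeff_C_mul, mul_sub, mul_sum]
  congr 1
  exact sum_congr rfl fun k _ => by ring

theorem BorelTo.sub {L : ℕ} {g h : ℕ → ℝ} {B B' : ℝ⟦X⟧} (hg : BorelTo L g B)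
    (hh : BorelTo L h B') : BorelTo L (fun N => g N - h N) (B - B') := by
  refine (IsBigO.sub hg hh).congr_left fun N => ?_
  simp only [borelSum, map_sub, mul_sub, sub_div, sum_sub_distrib]
  ring

theorem borelTo_zero_series (L : ℕ) : BorelTo L (fun _ => 0) 0 := by
  simp only [BorelTo, borelSum, map_zero, mul_zero, zero_div, sum_const_zero, sub_zero]
  exact isBigO_zero _ _

theorem BorelTo.sum {L : ℕ} {ι : Type*} {s : Finset ι} {g : ι → ℕ → ℝ} {B : ι → ℝ⟦X⟧}
    (h : ∀ i ∈ s, BorelTo L (g i) (B i)) :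
    BorelTo L (fun N => ∑ i ∈ s, g i N) (∑ i ∈ s, B i) := by
  classical
  induction s using Finset.induction_on with
  | empty => simpa using borelTo_zero_series L
  | insert a s ha ih =>
    simp only [sum_insert ha]
    exact (h a (mem_insert_self _ _)).add (ih fun i hi => h i (mem_insert_of_mem hi))

theorem BorelTo.congr_fun {L : ℕ} {g h : ℕ → ℝ} {B : ℝ⟦X⟧} (hg : BorelTo L g B)
    (e : g =ᶠ[atTop] h) : BorelTo L h B :=
  IsBigO.congr' hg (e.mono fun N hN => by simp only [hN]) EventuallyEq.rfl

/-- Integration by parts in the formal Laplace integral: N ∫ e^{-Nt} B = B(0) + ∫ e^{-Nt} B'. -/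
theorem mul_borelSum_succ (L : ℕ) (B : ℝ⟦X⟧) {N : ℝ} (hN : N ≠ 0) :
    N * borelSum (L + 1) B N = coeff 0 B + borelSum L (d⁄dX ℝ B) N := by
  rw [borelSum, sum_range_succ', mul_add, mul_sum, add_comm, borelSum]
  congr 1
  · rw [zero_add, pow_one, Nat.factorial_zero, Nat.cast_one, one_mul, mul_div_cancel₀ _ hN]
  · refine sum_congr rfl fun k _ => ?_
    rw [coeff_derivative, Nat.factorial_succ]
    push_cast
    field_simp
    ring

theorem BorelTo.mul_nat {L : ℕ} {g : ℕ → ℝ} {B : ℝ⟦X⟧} (hg : BorelTo (L + 1) g B) :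
    BorelTo L (fun N => N * g N - coeff 0 B) (d⁄dX ℝ B) := by
  refine (IsBigO.mul (isBigO_refl (fun N : ℕ => (N : ℝ)) atTop) hg).congr' ?_ ?_
  · filter_upwards [eventually_gt_atTop 0] with N hN
    rw [mul_sub, mul_borelSum_succ L B (by positivity)]
    ring
  · filter_upwards [eventually_gt_atTop 0] with N hN
    field_simp
    ring

theorem BorelTo.of_mul_nat {L : ℕ} {g : ℕ → ℝ} {B : ℝ⟦X⟧}
    (hg : BorelTo L (fun N => N * g N - coeff 0 B) (d⁄dX ℝ B)) : BorelTo (L + 1) g B := by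
  refine (IsBigO.mul (isBigO_refl (fun N : ℕ => (N : ℝ)⁻¹) atTop) hg).congr' ?_ ?_
  · filter_upwards [eventually_gt_atTop 0] with N hN
    have hN' : (N : ℝ) ≠ 0 := by positivity
    rw [sub_sub, ← mul_borelSum_succ L B hN', ← mul_sub, inv_mul_cancel_left₀ hN']
  · filter_upwards [eventually_gt_atTop 0] with N hN
    field_simp
    ring

theorem borelTo_zero_iff {g : ℕ → ℝ} {B : ℝ⟦X⟧} :
    BorelTo 0 g B ↔ g =O[atTop] fun N : ℕ => 1 / (N : ℝ) := by
  simp [BorelTo, borelSum]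

theorem BorelTo.isBigO {L : ℕ} {g : ℕ → ℝ} {B : ℝ⟦X⟧} (hg : BorelTo L g B)
    (hB : X ^ L ∣ B) : g =O[atTop] fun N : ℕ => 1 / (N : ℝ) ^ (L + 1) := by
  refine IsBigO.congr_left hg fun N => ?_
  rw [borelSum, sum_eq_zero, sub_zero]
  intro k hk
  rw [X_pow_dvd_iff.1 hB k (mem_range.1 hk), mul_zero, zero_div]

/-- The Borel transform of `N^{-k-1}`. -/
noncomputable def borelMonomial (k : ℕ) : ℝ⟦X⟧ := C (1 / (k.factorial : ℝ)) * X ^ k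

theorem derivative_borelMonomial_zero : d⁄dX ℝ (borelMonomial 0) = 0 := by
  simp [borelMonomial]

theorem derivative_borelMonomial_succ (k : ℕ) :
    d⁄dX ℝ (borelMonomial (k + 1)) = borelMonomial k := by
  ext n
  rw [coeff_derivative, borelMonomial, borelMonomial, coeff_C_mul, coeff_C_mul, coeff_X_pow,
    coeff_X_pow, Nat.factorial_succ]
  by_cases h : n = k
  · subst h
    simp only [if_true]
    push_cast
    field_simp
  · rw [if_neg h, if_neg (by omega)]
    simp

theorem coeff_zero_borelMonomial_zero : coeff 0 (borelMonomial 0) = 1 := by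
  simp [borelMonomial]

theorem coeff_zero_borelMonomial_succ (k : ℕ) : coeff 0 (borelMonomial (k + 1)) = 0 := by
  simp [borelMonomial]

theorem one_div_pow_succ_isBigO (k : ℕ) :
    (fun N : ℕ => 1 / (N : ℝ) ^ (k + 1)) =O[atTop] fun N : ℕ => 1 / (N : ℝ) := by
  refine IsBigO.of_bound 1 ?_
  filter_upwards [eventually_gt_atTop 0] with N hN
  have h1 : (1 : ℝ) ≤ N := by exact_mod_cast hN
  rw [one_mul, Real.norm_of_nonneg (by positivity), Real.norm_of_nonneg (by positivity)]
  exact one_div_le_one_div_of_le (by positivity) (le_self_pow₀ h1 (by omega))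

theorem borelTo_one_div_pow (L k : ℕ) :
    BorelTo L (fun N => 1 / (N : ℝ) ^ (k + 1)) (borelMonomial k) := by
  induction L generalizing k with
  | zero => exact borelTo_zero_iff.2 (one_div_pow_succ_isBigO k)
  | succ L ih =>
    apply BorelTo.of_mul_nat
    rcases k with _ | k
    · rw [derivative_borelMonomial_zero, coeff_zero_borelMonomial_zero]
      refine (borelTo_zero_series L).congr_fun ?_
      filter_upwards [eventually_gt_atTop 0] with N hN
      field_simp
      simp
    · rw [derivative_borelMonomial_succ, coeff_zero_borelMonomial_succ]
      refine (ih k).congr_fun ?_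
      filter_upwards [eventually_gt_atTop 0] with N hN
      field_simp
      simp [pow_succ]

/-- Induction on the order through N/(N+1)^{k+1} = 1/(N+1)^k - 1/(N+1)^{k+1}, which matches the
product rule for e^{-t} t^k/k!. -/
theorem borelTo_one_div_succ_pow (L k : ℕ) :
    BorelTo L (fun N => 1 / ((N : ℝ) + 1) ^ (k + 1)) (expSeries (-1) * borelMonomial k) := by
  have h0 : ∀ P, coeff 0 (expSeries (-1) * P) = coeff 0 P := fun P => by
    have := coeff_expSeries (-1) 0
    simp only [coeff_zero_eq_constantCoeff_apply, map_mul] at this ⊢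
    rw [this]
    simp
  have hd : d⁄dX ℝ (expSeries (-1)) = -expSeries (-1) := by
    rw [derivative_expSeries]
    simp
  induction L generalizing k with
  | zero =>
    refine borelTo_zero_iff.2 (IsBigO.trans (IsBigO.of_bound 1 ?_) (one_div_pow_succ_isBigO k))
    filter_upwards [eventually_gt_atTop 0] with N hN
    rw [one_mul, Real.norm_of_nonneg (by positivity), Real.norm_of_nonneg (by positivity)]
    exact one_div_le_one_div_of_le (by positivity)
      (pow_le_pow_left₀ (by positivity) (by linarith) _)
  | succ L ih =>
    apply BorelTo.of_mul_nat
    rw [h0, Derivation.leibniz, hd, smul_eq_mul, smul_eq_mul]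
    rcases k with _ | k
    · rw [derivative_borelMonomial_zero, coeff_zero_borelMonomial_zero,
        show expSeries (-1) * 0 + borelMonomial 0 * -expSeries (-1) =
          0 - expSeries (-1) * borelMonomial 0 by ring]
      refine ((borelTo_zero_series L).sub (ih 0)).congr_fun (Eventually.of_forall fun N => ?_)
      have : (N : ℝ) + 1 ≠ 0 := by positivity
      field_simp
      ring
    · rw [derivative_borelMonomial_succ, coeff_zero_borelMonomial_succ,
        show expSeries (-1) * borelMonomial k + borelMonomial (k + 1) * -expSeries (-1) =
          expSeries (-1) * borelMonomial k - expSeries (-1) * borelMonomial (k + 1) by ring]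
      refine ((ih k).sub (ih (k + 1))).congr_fun (Eventually.of_forall fun N => ?_)
      have : (N : ℝ) + 1 ≠ 0 := by positivity
      field_simp
      ring

/-- The truncation `∑_{k<L} B_k t^k`, as a series. -/
noncomputable def truncSeries (L : ℕ) (B : ℝ⟦X⟧) : ℝ⟦X⟧ :=
  ∑ k ∈ range L, C (k.factorial * coeff k B) * borelMonomial k

theorem coeff_truncSeries {L n : ℕ} (B : ℝ⟦X⟧) (h : n < L) :
    coeff n (truncSeries L B) = coeff n B := by
  rw [truncSeries, map_sum, sum_eq_single n]
  · rw [coeff_C_mul, borelMonomial, coeff_C_mul, coeff_X_pow, if_pos rfl]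
    field_simp
  · intro k _ hk
    rw [coeff_C_mul, borelMonomial, coeff_C_mul, coeff_X_pow, if_neg hk.symm, mul_zero, mul_zero]
  · exact fun hn => absurd (mem_range.2 h) hn

theorem X_pow_dvd_truncSeries_sub (L : ℕ) (B : ℝ⟦X⟧) : X ^ L ∣ truncSeries L B - B :=
  X_pow_dvd_iff.2 fun n hn => by rw [map_sub, coeff_truncSeries B hn, sub_self]

theorem X_pow_dvd_derivative {n : ℕ} {P : ℝ⟦X⟧} (h : X ^ (n + 1) ∣ P) : X ^ n ∣ d⁄dX ℝ P :=
  X_pow_dvd_iff.2 fun m hm => by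
    rw [coeff_derivative, X_pow_dvd_iff.1 h (m + 1) (by omega), zero_mul]

theorem borelTo_borelSum (M L : ℕ) (B : ℝ⟦X⟧) :
    BorelTo M (fun N => borelSum L B N) (truncSeries L B) :=
  (BorelTo.sum fun k _ => (borelTo_one_div_pow M k).const_mul (k.factorial * coeff k B)).congr_fun
    (Eventually.of_forall fun N => sum_congr rfl fun k _ => by ring)

theorem borelTo_borelSum_succ (M L : ℕ) (B : ℝ⟦X⟧) :
    BorelTo M (fun N => borelSum L B ((N : ℝ) + 1)) (expSeries (-1) * truncSeries L B) := by
  rw [truncSeries, mul_sum]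
  simp only [mul_left_comm (expSeries (-1))]
  exact (BorelTo.sum fun k _ =>
    (borelTo_one_div_succ_pow M k).const_mul (k.factorial * coeff k B)).congr_fun
    (Eventually.of_forall fun N => sum_congr rfl fun k _ => by ring)

/-- The terms of index L to M - 1 are themselves O(N^{-L-1}), so surplus terms may be dropped. -/
theorem BorelTo.of_sub_borelSum {L M : ℕ} (hLM : L ≤ M) {g : ℕ → ℝ} {B : ℝ⟦X⟧}
    (h : (fun N : ℕ => g N - borelSum M B N) =O[atTop] fun N : ℕ => 1 / (N : ℝ) ^ (L + 1)) :
    BorelTo L g B := by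
  refine (IsBigO.add h (borelTo_borelSum L M B)).congr_left fun N => ?_
  rw [show borelSum L (truncSeries M B) N = borelSum L B N from
    sum_congr rfl fun k hk => by
      rw [coeff_truncSeries B (lt_of_lt_of_le (mem_range.1 hk) hLM)]]
  ring

theorem borelTo_log_step (L : ℕ) :
    BorelTo L (fun N => Real.log ((N : ℝ) + 1) - Real.log N) logStepSeries := by
  refine IsBigO.of_bound 2 ?_
  filter_upwards [eventually_ge_atTop 2] with N hN
  have hN2 : (2 : ℝ) ≤ N := by exact_mod_cast hN
  have hN0 : (0 : ℝ) < N := by linarith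
  have hx : |-(1 / (N : ℝ))| ≤ 1 / 2 := by
    rw [abs_neg, abs_of_nonneg (by positivity)]
    exact one_div_le_one_div_of_le two_pos hN2
  have h := Real.abs_log_sub_add_sum_range_le (x := -(1 / (N : ℝ))) (by linarith) L
  have e1 : Real.log (1 - -(1 / (N : ℝ))) = Real.log ((N : ℝ) + 1) - Real.log N := by
    rw [← Real.log_div (by positivity) (by positivity)]
    congr 1
    field_simp
    ring
  have e2 : ∑ i ∈ range L, (-(1 / (N : ℝ))) ^ (i + 1) / ((i : ℝ) + 1) =
      -borelSum L logStepSeries N := by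
    rw [borelSum, ← sum_neg_distrib]
    refine sum_congr rfl fun k _ => ?_
    rw [logStepSeries, coeff_mk, Nat.factorial_succ, neg_pow, one_div, inv_pow]
    push_cast
    field_simp
    ring
  rw [e1, e2, neg_add_eq_sub] at h
  rw [Real.norm_eq_abs, Real.norm_of_nonneg (by positivity)]
  refine h.trans ?_
  rw [div_le_iff₀ (by linarith), abs_neg, abs_of_nonneg (a := 1 / (N : ℝ)) (by positivity),
    one_div_pow]
  rw [abs_neg, abs_of_nonneg (by positivity)] at hx
  nlinarith [show 0 < 1 / (N : ℝ) ^ (L + 1) by positivity]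

/-- A null sequence with increments `O(N^{-p-2})` is `O(N^{-p-1})`. -/
theorem isBigO_of_increment_isBigO {u : ℕ → ℝ} {p : ℕ} (h0 : Tendsto u atTop (nhds 0))
    (h : (fun N => u (N + 1) - u N) =O[atTop] fun N : ℕ => 1 / (N : ℝ) ^ (p + 2)) :
    u =O[atTop] fun N : ℕ => 1 / (N : ℝ) ^ (p + 1) := by
  obtain ⟨c, hc, hb⟩ := h.exists_pos
  rw [IsBigOWith, eventually_atTop] at hb
  obtain ⟨N₀, hb⟩ := hb
  have hw : Tendsto (fun N : ℕ => 2 * c * (1 / (N : ℝ) ^ (p + 1))) atTop (nhds 0) := by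
    have := ((tendsto_pow_atTop (α := ℝ) (n := p + 1) (by omega)).comp
      tendsto_natCast_atTop_atTop).inv_tendsto_atTop.const_mul (2 * c)
    simpa [Function.comp_def] using this
  -- A discrete substitute for integrating N^{-p-2}; the factor 2 works because 2N/(N+1) ≥ 1.
  have hstep : ∀ N : ℕ, 1 ≤ N → 1 / (N : ℝ) ^ (p + 2) ≤
      2 * (1 / (N : ℝ) ^ (p + 1) - 1 / ((N + 1 : ℕ) : ℝ) ^ (p + 1)) := fun N hN => by
    have hN1 : (1 : ℝ) ≤ N := by exact_mod_cast hN
    have hN0 : (0 : ℝ) < N := by linarith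
    have h1 : 1 / ((N + 1 : ℕ) : ℝ) ^ (p + 1) ≤ 1 / ((N : ℝ) ^ p * (N + 1)) := by
      push_cast
      refine one_div_le_one_div_of_le (by positivity) ?_
      rw [pow_succ]
      exact mul_le_mul_of_nonneg_right (pow_le_pow_left₀ hN0.le (by linarith) _) (by positivity)
    have h2 : 1 / (N : ℝ) ^ (p + 2) ≤
        2 * (1 / (N : ℝ) ^ (p + 1) - 1 / ((N : ℝ) ^ p * (N + 1))) := by
      have e : 2 * (1 / (N : ℝ) ^ (p + 1) - 1 / ((N : ℝ) ^ p * (N + 1))) =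
          1 / (N : ℝ) ^ (p + 2) * (2 * N / (N + 1)) := by
        field_simp
        ring
      rw [e]
      refine le_mul_of_one_le_right (by positivity) ?_
      rw [one_le_div (by positivity)]
      linarith
    linarith
  -- The sequence v_N + 2c/N^{p+1} is eventually decreasing with limit 0, hence nonnegative; this is
  -- applied to u and to -u.
  have key : ∀ v : ℕ → ℝ, Tendsto v atTop (nhds 0) →
      (∀ N ≥ N₀, |v (N + 1) - v N| ≤ c * (1 / (N : ℝ) ^ (p + 2))) →
      ∀ N ≥ max N₀ 1, 0 ≤ v N + 2 * c * (1 / (N : ℝ) ^ (p + 1)) := by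
    intro v hv hvb N hN
    have hanti : ∀ M ≥ N, v (M + 1) + 2 * c * (1 / ((M + 1 : ℕ) : ℝ) ^ (p + 1)) ≤
        v M + 2 * c * (1 / (M : ℝ) ^ (p + 1)) := fun M hM => by
      have hM0 : N₀ ≤ M := (le_max_left _ _).trans (hN.trans hM)
      have hM1 : 1 ≤ M := (le_max_right _ _).trans (hN.trans hM)
      have h1 := (abs_le.1 (hvb M hM0)).2
      have h2 := mul_le_mul_of_nonneg_left (hstep M hM1) hc.le
      linarith
    have hle : ∀ M ≥ N, v M + 2 * c * (1 / (M : ℝ) ^ (p + 1)) ≤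
        v N + 2 * c * (1 / (N : ℝ) ^ (p + 1)) := fun M hM => by
      induction M, hM using Nat.le_induction with
      | base => exact le_rfl
      | succ M hM ih => exact (hanti M hM).trans ih
    have hlim : Tendsto (fun M : ℕ => v M + 2 * c * (1 / (M : ℝ) ^ (p + 1))) atTop (nhds 0) := by
      simpa using hv.add hw
    exact le_of_tendsto hlim (eventually_atTop.2 ⟨N, hle⟩)
  have hb' : ∀ N ≥ N₀, |u (N + 1) - u N| ≤ c * (1 / (N : ℝ) ^ (p + 2)) := fun N hN => by
    have := hb N hN
    rwa [Real.norm_eq_abs, Real.norm_of_nonneg (by positivity)] at this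
  refine IsBigO.of_bound (2 * c) (eventually_atTop.2 ⟨max N₀ 1, fun N hN => ?_⟩)
  rw [Real.norm_eq_abs, Real.norm_of_nonneg (by positivity), abs_le]
  have h1 := key u h0 hb' N hN
  have h2 := key (fun N => -u N) (by simpa using h0.neg) (fun N hN => by
    rw [neg_sub_neg, abs_sub_comm]; exact hb' N hN) N hN
  constructor <;> linarith

end BorelExpansion

/-! ### From formal solutions to actual asymptotics. -/

section LandauExpansion

open PowerSeries Finset

/-- The full series solves the equation exactly, and two derivatives cost two orders of the
truncation error. -/
theorem X_pow_dvd_termSeries_residual (L : ℕ) :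
    X ^ L ∣ expSeries (-1) * d⁄dX ℝ (d⁄dX ℝ (truncSeries (L + 2) termSeries)) -
      (d⁄dX ℝ (d⁄dX ℝ (truncSeries (L + 2) termSeries)) + d⁄dX ℝ (truncSeries (L + 2) termSeries) +
        C (1 / 4 : ℝ) * truncSeries (L + 2) termSeries) := by
  have h0 := X_pow_dvd_truncSeries_sub (L + 2) termSeries
  have h1 := X_pow_dvd_derivative h0
  have h2 := X_pow_dvd_derivative h1
  simp only [map_sub] at h1 h2
  have h := termSeries_ode
  have := (((h2.mul_left (expSeries (-1))).sub h2).sub ((pow_dvd_pow X (Nat.le_succ L)).trans h1)).sub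
    (((pow_dvd_pow X (by omega : L ≤ L + 2)).trans h0).mul_left (C (1 / 4 : ℝ)))
  refine this.trans (dvd_of_eq ?_)
  linear_combination -h

theorem borelTo_residual (M L : ℕ) :
    BorelTo M (fun N => ((N : ℝ) + 1) ^ 2 * borelSum L termSeries ((N : ℝ) + 1) -
        ((N : ℝ) + 1 / 2) ^ 2 * borelSum L termSeries N)
      (expSeries (-1) * d⁄dX ℝ (d⁄dX ℝ (truncSeries L termSeries)) -
        (d⁄dX ℝ (d⁄dX ℝ (truncSeries L termSeries)) + d⁄dX ℝ (truncSeries L termSeries) +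
          C (1 / 4 : ℝ) * truncSeries L termSeries)) := by
  have hd : d⁄dX ℝ (expSeries (-1)) = -expSeries (-1) := by
    rw [derivative_expSeries]
    simp
  have h0 : ∀ P, coeff 0 (expSeries (-1) * P) = coeff 0 P := fun P => by
    have := coeff_expSeries (-1) 0
    simp only [coeff_zero_eq_constantCoeff_apply, map_mul] at this ⊢
    rw [this]
    simp
  have hg := fun M => borelTo_borelSum_succ M L termSeries
  have hA := fun M => borelTo_borelSum M L termSeries
  generalize truncSeries L termSeries = P at *
  have e1 : coeff 0 (d⁄dX ℝ (expSeries (-1) * P)) = coeff 0 (d⁄dX ℝ P) - coeff 0 P := by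
    rw [Derivation.leibniz, hd, smul_eq_mul, smul_eq_mul, map_add, h0, mul_neg, map_neg,
      mul_comm P, h0]
    ring
  have h := (((hg (M + 2)).mul_nat.mul_nat.add ((hg (M + 1)).mul_nat.const_mul 2)).add (hg M)).sub
    (((hA (M + 2)).mul_nat.mul_nat.add (hA (M + 1)).mul_nat).add ((hA M).const_mul (1 / 4)))
  rw [h0, e1] at h
  -- (N+1)² acts as (d/dt + 1)², and the factor e^{-t} absorbs the shift by 1.
  have e2 : d⁄dX ℝ (d⁄dX ℝ (expSeries (-1) * P)) + C (2 : ℝ) * d⁄dX ℝ (expSeries (-1) * P) +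
      expSeries (-1) * P = expSeries (-1) * d⁄dX ℝ (d⁄dX ℝ P) := by
    rw [show C (2 : ℝ) = (2 : ℝ⟦X⟧) from map_ofNat C 2]
    simp only [Derivation.leibniz, map_add, map_neg, hd, smul_eq_mul, mul_neg]
    ring
  rw [e2] at h
  exact h.congr_fun (Eventually.of_forall fun N => by ring)

theorem tendsto_mul_borelSum_termSeries (L : ℕ) :
    Tendsto (fun N : ℕ => (N : ℝ) * borelSum (L + 1) termSeries N) atTop (nhds 1) := by
  have h := borelTo_zero_iff.1 (borelTo_borelSum 1 (L + 1) termSeries).mul_nat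
  rw [coeff_truncSeries _ (Nat.succ_pos L), coeff_zero_termSeries] at h
  have := (h.trans_tendsto tendsto_one_div_atTop_nhds_zero_nat).add_const 1
  simpa using this

/-- The truncated formal solution A nearly satisfies the recurrence of a = π c². The ratio A/a
therefore has small increments; it tends to 1, so 1 - A/a is small, and multiplying back by a gives
a - A. -/
theorem borelTo_pi_mul_cbRatio_sq (L : ℕ) :
    BorelTo L (fun N => Real.pi * cbRatio N ^ 2) termSeries := by
  have hapos : ∀ N, 0 < Real.pi * cbRatio N ^ 2 := fun N =>
    mul_pos Real.pi_pos (pow_pos (cbRatio_pos N) 2)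
  have hlim := tendsto_mul_pi_mul_cbRatio_sq
  have hrec : ∀ N : ℕ, ((N : ℝ) + 1) ^ 2 * (Real.pi * cbRatio (N + 1) ^ 2) =
      ((N : ℝ) + 1 / 2) ^ 2 * (Real.pi * cbRatio N ^ 2) := fun N => by
    rw [cbRatio_succ]
    field_simp
  generalize ha : (fun N => Real.pi * cbRatio N ^ 2) = a at *
  have ha' : ∀ N, Real.pi * cbRatio N ^ 2 = a N := fun N => by rw [← ha]
  simp only [ha'] at hapos hlim hrec
  -- Two of the three extra terms are lost to the second derivatives, the third to summing the
  -- increments.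
  set A : ℕ → ℝ := fun N => borelSum (L + 1 + 2) termSeries N with hA
  have hr := (borelTo_residual (L + 1) (L + 1 + 2)).isBigO (X_pow_dvd_termSeries_residual (L + 1))
  have hAlim : Tendsto (fun N : ℕ => (N : ℝ) * A N) atTop (nhds 1) :=
    tendsto_mul_borelSum_termSeries (L + 2)
  have hu0 : Tendsto (fun N => 1 - A N / a N) atTop (nhds 0) := by
    have := (tendsto_const_nhds (x := (1 : ℝ))).sub (hAlim.div hlim one_ne_zero)
    rw [div_one, sub_self] at this
    refine this.congr' ?_
    filter_upwards [eventually_gt_atTop 0] with N hN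
    have : (N : ℝ) ≠ 0 := by positivity
    simp only [Pi.div_apply]
    rw [mul_div_mul_left _ _ this]
  have hweight : (fun N : ℕ => 1 / (((N : ℝ) + 1 / 2) ^ 2 * a N)) =O[atTop]
      fun _ => (1 : ℝ) := by
    refine IsBigO.of_bound 2 ?_
    filter_upwards [hlim.eventually (lt_mem_nhds (show (1 / 2 : ℝ) < 1 by norm_num)),
      eventually_ge_atTop 1] with N hN hN1
    have hN1' : (1 : ℝ) ≤ N := by exact_mod_cast hN1
    have hp := hapos N
    rw [Real.norm_of_nonneg (by positivity), norm_one, mul_one, div_le_iff₀ (by positivity)]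
    nlinarith [mul_nonneg (sub_nonneg.2 hN1') (by positivity : 0 ≤ (N : ℝ) * a N)]
  have hinc : (fun N => (1 - A (N + 1) / a (N + 1)) - (1 - A N / a N)) =O[atTop]
      fun N : ℕ => 1 / (N : ℝ) ^ (L + 2) := by
    refine ((hr.mul hweight).neg_left).congr (fun N => ?_) fun N => mul_one _
    have h1 := (hapos N).ne'
    have h2 : a (N + 1) = ((N : ℝ) + 1 / 2) ^ 2 * a N / ((N : ℝ) + 1) ^ 2 := by
      rw [← hrec]; field_simp
    rw [h2, hA]
    push_cast
    field_simp
    ring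
  have hu := isBigO_of_increment_isBigO hu0 hinc
  have haO : a =O[atTop] fun _ => (1 : ℝ) := by
    refine IsBigO.of_bound 2 ?_
    filter_upwards [hlim.eventually (gt_mem_nhds (show (1 : ℝ) < 2 by norm_num)),
      eventually_ge_atTop 1] with N hN hN1
    have hN1' : (1 : ℝ) ≤ N := by exact_mod_cast hN1
    have hp := hapos N
    rw [Real.norm_of_nonneg hp.le, norm_one]
    nlinarith
  refine BorelTo.of_sub_borelSum (M := L + 1 + 2) (by omega) ?_
  refine (haO.mul hu).congr (fun N => ?_) fun N => one_mul _
  have h1 := (hapos N).ne'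
  field_simp
  rfl

theorem landau_sum_isBigO (L : ℕ) :
    (fun N : ℕ => ∑ k ∈ range N, Real.pi * cbRatio k ^ 2 - Real.log N -
      (Real.log 16 + Real.eulerMascheroniConstant) - borelSum L borelSeries N)
      =O[atTop] fun N : ℕ => 1 / (N : ℝ) ^ (L + 1) := by
  apply isBigO_of_increment_isBigO
  · have h1 := borelTo_zero_iff.1 (borelTo_borelSum 0 L borelSeries)
    have h2 := h1.trans_tendsto tendsto_one_div_atTop_nhds_zero_nat
    have h3 := (tendsto_sum_pi_mul_cbRatio_sq_sub_log.sub_const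
      (Real.log 16 + Real.eulerMascheroniConstant)).sub h2
    simpa using h3
  · have h := ((borelTo_pi_mul_cbRatio_sq (L + 1)).sub (borelTo_log_step (L + 1))).sub
      ((borelTo_borelSum_succ (L + 1) L borelSeries).sub (borelTo_borelSum (L + 1) L borelSeries))
    have hdvd : X ^ (L + 1) ∣ termSeries - logStepSeries -
        (expSeries (-1) * truncSeries L borelSeries - truncSeries L borelSeries) := by
      have e : termSeries - logStepSeries -
          (expSeries (-1) * truncSeries L borelSeries - truncSeries L borelSeries) =
          -- The factor 1 - e^{-t} supplies the extra power of t that the summation of increments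
          -- consumes.
          X * logStepSeries * (truncSeries L borelSeries - borelSeries) := by
        rw [X_mul_logStepSeries]
        linear_combination termSeries_eq
      rw [e, pow_succ']
      exact mul_dvd_mul (dvd_mul_right _ _) (X_pow_dvd_truncSeries_sub L borelSeries)
    refine (h.isBigO hdvd).congr_left fun N => ?_
    rw [sum_range_succ]
    push_cast
    ring

/-- The coefficients `α_{k+1} = k! β_k`. -/
noncomputable def granathCoeff (k : ℕ) : ℝ := (k - 1).factorial * coeff (k - 1) borelSeries

theorem pi_mul_landauConstant (n : ℕ) :
    Real.pi * landauConstant n = ∑ k ∈ range (n + 1), Real.pi * cbRatio k ^ 2 := by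
  rw [landauConstant, mul_sum]
  rfl

theorem granathTruncation_granathCoeff (l : ℕ) {N : ℝ} (hN : N ≠ 0) :
    granathTruncation granathCoeff l N = Real.log N +
      (Real.log 16 + Real.eulerMascheroniConstant) + borelSum l borelSeries N := by
  rw [granathTruncation, Real.log_mul (by norm_num) hN, ← Finset.Ico_add_one_right_eq_Icc,
    sum_Ico_eq_sum_range, borelSum]
  have : ∑ k ∈ range (l + 1 - 1), granathCoeff (1 + k) / N ^ (1 + k) =
      ∑ k ∈ range l, k.factorial * coeff k borelSeries / N ^ (k + 1) :=
    sum_congr rfl fun k _ => by rw [granathCoeff, Nat.add_sub_cancel_left, add_comm 1 k]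
  rw [this]
  ring

theorem isGranathExpansion_granathCoeff : IsGranathExpansion granathCoeff := by
  intro l
  have hlittle : (fun N : ℕ => 1 / (N : ℝ) ^ (l + 1)) =o[atTop] fun N : ℕ => 1 / (N : ℝ) ^ l := by
    have h1 : (fun N : ℕ => 1 / (N : ℝ)) =o[atTop] fun _ => (1 : ℝ) :=
      (isLittleO_one_iff ℝ).2 tendsto_one_div_atTop_nhds_zero_nat
    refine (h1.mul_isBigO (isBigO_refl (fun N : ℕ => 1 / (N : ℝ) ^ l) atTop)).congr
      (fun N => ?_) fun N => one_mul _
    rw [one_div_mul_one_div, pow_succ']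
  have h := ((landau_sum_isBigO l).trans_isLittleO hlittle).comp_tendsto (tendsto_add_atTop_nat 1)
  refine h.congr (fun n => ?_) fun n => ?_
  · have : (n : ℝ) + 1 ≠ 0 := by positivity
    rw [pi_mul_landauConstant, granathTruncation_granathCoeff l this]
    simp only [Function.comp_apply]
    push_cast
    ring
  · simp

theorem granathTruncation_succ (α : ℕ → ℝ) (l : ℕ) (N : ℝ) :
    granathTruncation α (l + 1) N = granathTruncation α l N + α (l + 1) / N ^ (l + 1) := by
  rw [granathTruncation, granathTruncation, sum_Icc_succ_top (by omega)]
  ring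

/-- If the earlier coefficients agree, the difference of the two order-(l+1) errors times N^{l+1} is
the constant α_{l+1} - β_{l+1}, and it is o(1). -/
theorem IsGranathExpansion.coeff_unique {α β : ℕ → ℝ} (hα : IsGranathExpansion α)
    (hβ : IsGranathExpansion β) (l : ℕ) : α (l + 1) = β (l + 1) := by
  induction l using Nat.strong_induction_on with
  | _ l ih =>
    have h := (hβ (l + 1)).sub (hα (l + 1))
    have e : ∀ N, granathTruncation α l N = granathTruncation β l N := fun N => by
      rw [granathTruncation, granathTruncation]
      congr 1
      refine sum_congr rfl fun k hk => ?_
      rw [mem_Icc] at hk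
      obtain ⟨j, rfl⟩ := Nat.exists_eq_add_of_le' hk.1
      rw [ih j (by omega)]
    have h2 := h.mul_isBigO (isBigO_refl (fun n : ℕ => ((n : ℝ) + 1) ^ (l + 1)) atTop)
    have h3 : (fun _ : ℕ => α (l + 1) - β (l + 1)) =o[atTop] fun _ : ℕ => (1 : ℝ) := by
      refine h2.congr (fun n => ?_) fun n => ?_
      · rw [granathTruncation_succ, granathTruncation_succ, e]
        have : (n : ℝ) + 1 ≠ 0 := by positivity
        field_simp
        ring
      · have : (n : ℝ) + 1 ≠ 0 := by positivity
        field_simp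
    exact sub_eq_zero.1 (tendsto_nhds_unique tendsto_const_nhds ((isLittleO_one_iff ℝ).1 h3))

theorem sign_granathCoeff (l : ℕ) :
    (-1 : ℝ) ^ (l * (l + 1) / 2) * granathCoeff (l + 1) < 0 := by
  have h := mul_pos (Nat.cast_pos.2 l.factorial_pos : (0 : ℝ) < l.factorial)
    (sign_coeff_landauSeries l)
  rw [granathCoeff, Nat.add_sub_cancel, borelSeries, coeff_mk]
  linarith

end LandauExpansion

theorem theorem1 :
    (∃ α : ℕ → ℝ, IsGranathExpansion α) ∧
      ∀ α : ℕ → ℝ, IsGranathExpansion α →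
        ∀ l : ℕ, (-1 : ℝ) ^ (l * (l + 1) / 2) * α (l + 1) < 0 := by
  refine ⟨⟨granathCoeff, isGranathExpansion_granathCoeff⟩, fun α hα l => ?_⟩
  rw [hα.coeff_unique isGranathExpansion_granathCoeff l]
  exact sign_granathCoeff l
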